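/- Let $\Gamma$ be a group with a given orientation-preserving action by homeomorphisms on the circle $S^1=\mathbb{R}/\mathbb{Z}$. For $g\in\Gamma$ let $F_g\colon\mathbb{R}\to\mathbb{R}$ be the increasing lift of the action of $g$ with $F_g(0)\in[0,1)$, which commutes with $x\mapsto x+1$, and let $c(g,h)\in\{0,1\}$ be the integer with $F_g\circ F_h=F_{gh}+c(g,h)$. The class of the cocycle $c$ in $H^2(\Gamma;\mathbb{Z})$ is the Euler class $\mathrm{eu}$, and the class of $c$ in bounded cohomology $H^2_b(\Gamma;\mathbb{R})$ is the bounded Euler class $\mathrm{eu}_b$. Assume that * $\Gamma$ is finitely presented and $H_1(\Gamma;\mathbb{Z})$ is finite; * every quasi-morphism $\Gamma\to\mathbb{R}$ is trivial, i.e., at bounded distance from a homomorphism; * $H^2_b(\Gamma;\mathbb{R})\cong\mathbb{R}$, generated by $\mathrm{eu}_b$. Let $\widetilde\Gamma$ be the central extension group of $\Gamma$ by $\mathbb{Z}$ with class $\mathrm{eu}$, let $H:=H_2(\Gamma;\mathbb{Z})$, and for an abelian group $A$ with trivial $\Gamma$-action and $\varphi\in H^2(\Gamma;A)$ let $\langle\varphi,\cdot\rangle\colon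 H\to A$ be the evaluation map. Then: 1. The evaluation map $\langle\mathrm{eu},\cdot\rangle\colon H\to\mathbb{Z}$ is non-trivial. 2. Let $m\in\mathbb{N}_{>0}$ be the positive generator of the image of $\langle\mathrm{eu},\cdot\rangle$ and let $\epsilon:=\frac1m\langle\mathrm{eu},\cdot\rangle\colon H\to\mathbb{Z}$. Then there exists a class $\varphi\in H^2(\Gamma;H)$ with $$H^2(\mathrm{id}_\Gamma;\epsilon)(\varphi)=\mathrm{eu}\quad\text{and}\quad\langle\varphi,\cdot\rangle=m\cdot\mathrm{id}_H.$$ 3. For every such $\varphi$, let $E$ be the central extension group of $\Gamma$ by $H$ with class $\varphi$. Then there exists an epimorphism $\psi\colon E\to\widetilde\Gamma$ with $\psi|_H=\epsilon\colon H\to\mathbb{Z}$ and $\ker\psi\subset H$. -/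

import Mathlib

noncomputable section

namespace EulerExt

/-! ### Integral homology, cohomology with trivial coefficients, and evaluation -/

/-- The abelian group `M` with the trivial action of `Γ`. -/
abbrev triv (Γ : Type) [Group Γ] (M : Type) [AddCommGroup M] : Rep ℤ Γ := Rep.trivial ℤ Γ M

/-- `H_1(Γ; ℤ)`. -/
abbrev H₁ (Γ : Type) [Group Γ] : ModuleCat ℤ := groupHomology.H1 (triv Γ ℤ)

/-- `H_2(Γ; ℤ)`. -/
abbrev H₂ (Γ : Type) [Group Γ] : ModuleCat ℤ := groupHomology.H2 (triv Γ ℤ)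

/-- `H^2(Γ; M)`, where `Γ` acts trivially on the abelian group `M`. -/
abbrev Hup₂ (Γ : Type) [Group Γ] (M : Type) [AddCommGroup M] : ModuleCat ℤ :=
  groupCohomology.H2 (triv Γ M)

section Evaluation

variable {Γ : Type} [Group Γ] {M : Type} [AddCommGroup M]

/-- The map `H^2(id_Γ; f) : H^2(Γ; M) → H^2(Γ; N)` induced by a homomorphism of coefficients. -/
def coeffMap {N : Type} [AddCommGroup N] (f : M →+ N) : Hup₂ Γ M →+ Hup₂ Γ N :=
  ((groupCohomology.functor ℤ Γ 2).map
    ((Rep.trivialFunctor ℤ Γ).map (ModuleCat.ofHom f.toIntLinearMap))).hom.toAddMonoidHom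

/-- The pairing of `2`-cochains with `2`-chains: `⟨c, ∑ nᵢ (gᵢ, hᵢ)⟩ = ∑ nᵢ c(gᵢ, hᵢ)`. -/
def chainPairing {Γ M : Type} [AddCommGroup M] : (Γ × Γ → M) →+ (Γ × Γ →₀ ℤ) →+ M :=
  AddMonoidHom.mk' (fun c => AddMonoidHom.mk' (fun z : Γ × Γ →₀ ℤ => z.sum fun p n => n • c p)
      fun z z' => Finsupp.sum_add_index' (by simp) (by simp [add_smul]))
    fun c c' => by ext; simp

lemma chainPairing_single {Γ M : Type} [AddCommGroup M] (c : Γ × Γ → M) (p : Γ × Γ) (n : ℤ) :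
    chainPairing c (Finsupp.single p n) = n • c p := by
  simp [chainPairing]

lemma chainPairing_boundary (c : groupCohomology.cocycles₂ (triv Γ M))
    (w : Γ × Γ × Γ →₀ ℤ) :
    chainPairing (c : Γ × Γ → M) (groupHomology.d₃₂ (triv Γ ℤ) w) = 0 := by
  induction w using Finsupp.induction_linear with
  | zero => simp only [map_zero]
  | add x y hx hy => rw [map_add, map_add, hx, hy, add_zero]
  | single p n =>
    obtain ⟨g, h, k⟩ := p
    have hc := (groupCohomology.mem_cocycles₂_def c.1).1 c.2 g h k
    change c (h, k) - c (g * h, k) + c (g, h * k) - c (g, h) = 0 at hc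
    rw [groupHomology.d₃₂_single]
    change chainPairing (c : Γ × Γ → M) (Finsupp.single (h, k) n - Finsupp.single (g * h, k) n +
      Finsupp.single (g, h * k) n - Finsupp.single (g, h) n) = 0
    simp only [map_sub, map_add, chainPairing_single]
    rw [← smul_sub, ← smul_add, ← smul_sub, hc, smul_zero]

lemma chainPairing_coboundary (u : Γ → M)
    (z : groupHomology.cycles₂ (triv Γ ℤ)) :
    chainPairing (groupCohomology.d₁₂ (triv Γ M) u : Γ × Γ → M) z.1 = 0 := by
  have key : ∀ y : Γ × Γ →₀ ℤ,
      chainPairing (groupCohomology.d₁₂ (triv Γ M) u : Γ × Γ → M) y =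
        Finsupp.linearCombination ℤ u (groupHomology.d₂₁ (triv Γ ℤ) y) := by
    intro y
    induction y using Finsupp.induction_linear with
    | zero => simp only [map_zero]
    | add x y hx hy => rw [map_add, map_add, map_add, hx, hy]
    | single p n =>
      obtain ⟨g, h⟩ := p
      rw [groupHomology.d₂₁_single, chainPairing_single]
      change n • (u h - u (g * h) + u g) = Finsupp.linearCombination ℤ u
        (Finsupp.single h n - Finsupp.single (g * h) n + Finsupp.single g n)
      simp [smul_sub, smul_add]
  have hz : groupHomology.d₂₁ (triv Γ ℤ) z.1 = 0 := z.2
  rw [key, hz, map_zero]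

/-- The unique homomorphism `Y → Z` through which `f` factors, if `p : X → Y` is onto and
`ker p ≤ ker f`. -/
def descend {X Y Z : Type} [AddCommGroup X] [AddCommGroup Y] [AddCommGroup Z]
    (p : X →+ Y) (hp : Function.Surjective p) (f : X →+ Z) (h : p.ker ≤ f.ker) : Y →+ Z :=
  p.liftOfSurjective hp ⟨f, h⟩

lemma descend_apply {X Y Z : Type} [AddCommGroup X] [AddCommGroup Y] [AddCommGroup Z]
    (p : X →+ Y) (hp : Function.Surjective p) (f : X →+ Z) (h : p.ker ≤ f.ker) (x : X) :
    descend p hp f h (p x) = f x :=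
  p.liftOfRightInverse_comp_apply _ (Function.rightInverse_surjInv hp) ⟨f, h⟩ x

lemma homologyπ_surjective :
    Function.Surjective (groupHomology.H2π (triv Γ ℤ)).hom :=
  (ModuleCat.epi_iff_surjective _).1 inferInstance

lemma cohomologyπ_surjective :
    Function.Surjective (groupCohomology.H2π (triv Γ M)).hom :=
  (ModuleCat.epi_iff_surjective _).1 inferInstance

/-- Evaluation of a cocycle on homology classes. -/
def evalCocycle : groupCohomology.cocycles₂ (triv Γ M) →+ (H₂ Γ →+ M) :=
  AddMonoidHom.mk' (fun c =>
    descend (groupHomology.H2π (triv Γ ℤ)).hom.toAddMonoidHom homologyπ_surjective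
      ((chainPairing (c : Γ × Γ → M)).comp
        (groupHomology.cycles₂ (triv Γ ℤ)).subtype.toAddMonoidHom)
      (by
        intro z hz
        obtain ⟨w, hw⟩ := (groupHomology.H2π_eq_zero_iff z).1 hz
        change chainPairing (c : Γ × Γ → M) z.1 = 0
        rw [← hw]
        exact chainPairing_boundary c w))
    (by
      intro c c'
      ext x
      obtain ⟨z, rfl⟩ := homologyπ_surjective x
      refine (descend_apply _ _ _ _ z).trans ?_
      refine (DFunLike.congr_fun (map_add chainPairing c.1 c'.1) z.1).trans ?_
      refine congrArg₂ (fun a b : M => a + b) (Eq.symm ?_) (Eq.symm ?_)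
      · exact descend_apply _ _ _ _ z
      · exact descend_apply _ _ _ _ z)

lemma evalCocycle_apply (c : groupCohomology.cocycles₂ (triv Γ M))
    (z : groupHomology.cycles₂ (triv Γ ℤ)) :
    evalCocycle c (groupHomology.H2π (triv Γ ℤ) z) = chainPairing (c : Γ × Γ → M) z.1 :=
  descend_apply _ _ _ _ z

/-- The evaluation `φ ↦ ⟨φ, ·⟩`, `H^2(Γ; M) → Hom(H_2(Γ; ℤ), M)`. -/
def kroneckerEval : Hup₂ Γ M →+ (H₂ Γ →+ M) :=
  descend (groupCohomology.H2π (triv Γ M)).hom.toAddMonoidHom cohomologyπ_surjective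
    evalCocycle
    (by
      intro c hc
      obtain ⟨u, hu⟩ := (groupCohomology.H2π_eq_zero_iff c).1 hc
      rw [AddMonoidHom.mem_ker]
      ext x
      obtain ⟨z, rfl⟩ := homologyπ_surjective x
      refine (evalCocycle_apply c z).trans ?_
      rw [← hu]
      exact chainPairing_coboundary u z)

/-- Evaluation is computed on representatives. -/
lemma kroneckerEval_apply (c : groupCohomology.cocycles₂ (triv Γ M))
    (z : groupHomology.cycles₂ (triv Γ ℤ)) :
    kroneckerEval (groupCohomology.H2π (triv Γ M) c)
      (groupHomology.H2π (triv Γ ℤ) z) = z.1.sum fun p n => n • (c p : M) :=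
  (DFunLike.congr_fun (descend_apply _ _ _ _ c) _).trans (evalCocycle_apply c z)

end Evaluation

/-! ### Central extensions and their classes -/

/-- The extension `1 → M → E → Γ → 1` is central, and `φ ∈ H^2(Γ; M)` is its class: some
set-theoretic section `s` satisfies `s(g) s(h) = c(g, h) s(gh)` with a cocycle `c` in the
class `φ`. -/
def HasClass {Γ : Type} [Group Γ] {M : Type} [AddCommGroup M]
    {E : Type*} [Group E] (S : GroupExtension (Multiplicative M) E Γ) (φ : Hup₂ Γ M) : Prop :=
  S.inl.range ≤ Subgroup.center E ∧
    ∃ (s : S.Section) (c : groupCohomology.cocycles₂ (triv Γ M)),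
      groupCohomology.H2π (triv Γ M) c = φ ∧
      ∀ g h : Γ, s g * s h = S.inl (Multiplicative.ofAdd (c (g, h))) * s (g * h)

/-- Every class in `H^2(Γ; M)` is the class of a central extension. -/
lemma exists_hasClass {Γ : Type} [Group Γ] {M : Type} [AddCommGroup M] (φ : Hup₂ Γ M) :
    ∃ (E : Type) (_ : Group E) (S : GroupExtension (Multiplicative M) E Γ), HasClass S φ := by
  obtain ⟨c, rfl⟩ := cohomologyπ_surjective φ
  let f : Γ → Γ → M := fun g h => c (g, h)
  have hf : ∀ g h k, f (g * h) k + f g h = f h k + f g (h * k) :=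
    fun g h k => (groupCohomology.mem_cocycles₂_iff c.1).1 c.2 g h k
  have h1 : ∀ g, f 1 g = f 1 1 := fun g => by
    have := hf 1 1 g
    simp only [one_mul] at this
    exact (add_left_cancel this).symm
  have h2 : ∀ g, f g 1 = f 1 1 := fun g => by
    have := hf g 1 1
    simp only [mul_one] at this
    exact add_right_cancel this
  let G : Group (M × Γ) := @Group.ofLeftAxioms (M × Γ)
    ⟨fun x y => (x.1 + y.1 + f x.2 y.2, x.2 * y.2)⟩
    ⟨fun x => (-x.1 - f x.2⁻¹ x.2 - f 1 1, x.2⁻¹)⟩ ⟨(-f 1 1, 1)⟩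
    (fun x y z => Prod.ext
      (by
        change x.1 + y.1 + f x.2 y.2 + z.1 + f (x.2 * y.2) z.2 =
          x.1 + (y.1 + z.1 + f y.2 z.2) + f x.2 (y.2 * z.2)
        have := hf x.2 y.2 z.2
        calc _ = x.1 + y.1 + z.1 + (f (x.2 * y.2) z.2 + f x.2 y.2) := by abel
          _ = _ := by rw [this]; abel) (mul_assoc _ _ _))
    (fun x => Prod.ext (by change -f 1 1 + x.1 + f 1 x.2 = x.1; rw [h1 x.2]; abel) (one_mul _))
    (fun x => Prod.ext
      (by change -x.1 - f x.2⁻¹ x.2 - f 1 1 + x.1 + f x.2⁻¹ x.2 = -f 1 1; abel)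
      (inv_mul_cancel _))
  have mulDef : ∀ x y : M × Γ, x * y = (x.1 + y.1 + f x.2 y.2, x.2 * y.2) := fun _ _ => rfl
  have oneDef : (1 : M × Γ) = (-f 1 1, 1) := rfl
  let i : Multiplicative M →* M × Γ := MonoidHom.mk' (fun a => (a.toAdd - f 1 1, 1)) fun a b => by
    rw [mulDef]
    exact Prod.ext (by simp only [toAdd_mul]; abel) (one_mul 1).symm
  let r : M × Γ →* Γ := MonoidHom.mk' (fun x => x.2) fun _ _ => rfl
  let S : GroupExtension (Multiplicative M) (M × Γ) Γ :=
    { inl := i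
      rightHom := r
      inl_injective := fun a b h => by
        have : a.toAdd - f 1 1 = b.toAdd - f 1 1 := congrArg Prod.fst h
        exact Multiplicative.toAdd.injective (sub_left_injective this)
      range_inl_eq_ker_rightHom := by
        ext x
        constructor
        · rintro ⟨a, rfl⟩
          rfl
        · intro hx
          have hx : x.2 = 1 := hx
          exact ⟨Multiplicative.ofAdd (x.1 + f 1 1),
            Prod.ext (add_sub_cancel_right x.1 (f 1 1)) hx.symm⟩
      rightHom_surjective := fun g => ⟨(0, g), rfl⟩ }
  refine ⟨M × Γ, G, S, ?_, ⟨fun g => (0, g), fun g => rfl⟩, c, rfl, fun g h => ?_⟩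
  · rintro _ ⟨a, rfl⟩
    rw [Subgroup.mem_center_iff]
    intro x
    refine Prod.ext ?_ ((mul_one x.2).trans (one_mul x.2).symm)
    change x.1 + (a.toAdd - f 1 1) + f x.2 1 = a.toAdd - f 1 1 + x.1 + f 1 x.2
    rw [h1 x.2, h2 x.2]; abel
  · refine Prod.ext ?_ (one_mul _).symm
    change 0 + 0 + f g h = f g h - f 1 1 + 0 + f 1 (g * h)
    rw [h1 (g * h)]; abel

/-! ### Quasi-morphisms and bounded cohomology in degree two -/

/-- A quasi-morphism is a function `f : Γ → ℝ` with `sup |f(gh) - f(g) - f(h)| < ∞`. -/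
def IsQuasimorphism {Γ : Type} [Group Γ] (f : Γ → ℝ) : Prop :=
  ∃ D : ℝ, ∀ g h : Γ, |f (g * h) - f g - f h| ≤ D

/-- A quasi-morphism is trivial if it is at bounded distance from a homomorphism. -/
def IsTrivialQuasimorphism {Γ : Type} [Group Γ] (f : Γ → ℝ) : Prop :=
  ∃ (χ : Γ →* Multiplicative ℝ) (D : ℝ), ∀ g : Γ, |f g - (χ g).toAdd| ≤ D

/-- The bounded real-valued functions on `X`. -/
def boundedFun (X : Type) : Submodule ℝ (X → ℝ) where
  carrier := {f | ∃ D : ℝ, ∀ x, |f x| ≤ D}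
  zero_mem' := ⟨0, by simp⟩
  add_mem' := by
    rintro f g ⟨D, hD⟩ ⟨D', hD'⟩
    exact ⟨D + D', fun x => (abs_add_le _ _).trans (add_le_add (hD x) (hD' x))⟩
  smul_mem' := by
    rintro a f ⟨D, hD⟩
    refine ⟨|a| * D, fun x => ?_⟩
    rw [Pi.smul_apply, smul_eq_mul, abs_mul]
    exact mul_le_mul_of_nonneg_left (hD x) (abs_nonneg a)

/-- Bounded inhomogeneous real `2`-cocycles. -/
def boundedCocycles (Γ : Type) [Group Γ] : Submodule ℝ (Γ × Γ → ℝ) :=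
  groupCohomology.cocycles₂ (Rep.trivial ℝ Γ ℝ) ⊓ boundedFun (Γ × Γ)

/-- Coboundaries of bounded real `1`-cochains. -/
def boundedCoboundaries (Γ : Type) [Group Γ] : Submodule ℝ (Γ × Γ → ℝ) :=
  (boundedFun Γ).map (groupCohomology.d₁₂ (Rep.trivial ℝ Γ ℝ)).hom

/-- Bounded cohomology `H^2_b(Γ; ℝ)`. -/
abbrev Hb₂ (Γ : Type) [Group Γ] : Type :=
  boundedCocycles Γ ⧸ (boundedCoboundaries Γ).submoduleOf (boundedCocycles Γ)

/-! ### Circle actions and the Euler class -/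

/-- `F : ℝ → ℝ` is a continuous non-decreasing lift, commuting with `x ↦ x + 1`, of the
self-homeomorphism `f` of the circle `ℝ / ℤ`. -/
def IsLift (F : CircleDeg1Lift) (f : UnitAddCircle ≃ₜ UnitAddCircle) : Prop :=
  Continuous F ∧ ∀ x : ℝ, ((F x : ℝ) : UnitAddCircle) = f (x : UnitAddCircle)

/-- A homeomorphism of the circle preserves the orientation if it has a lift to `ℝ` that is
increasing and commutes with `x ↦ x + 1`. -/
def OrientationPreserving (f : UnitAddCircle ≃ₜ UnitAddCircle) : Prop :=
  ∃ F : CircleDeg1Lift, IsLift F f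

lemma OrientationPreserving.exists_normalized {f : UnitAddCircle ≃ₜ UnitAddCircle}
    (hf : OrientationPreserving f) :
    ∃ F : CircleDeg1Lift, IsLift F f ∧ F 0 ∈ Set.Ico (0 : ℝ) 1 := by
  obtain ⟨F, hF, hF'⟩ := hf
  refine ⟨CircleDeg1Lift.translate (Multiplicative.ofAdd (-(⌊F 0⌋ : ℝ))) * F, ⟨?_, ?_⟩, ?_⟩
  · simp only [CircleDeg1Lift.coe_mul]
    have : Continuous fun x => -(⌊F 0⌋ : ℝ) + F x := by fun_prop
    simpa [Function.comp_def] using this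
  · intro x
    rw [← hF' x]
    simp only [CircleDeg1Lift.mul_apply, CircleDeg1Lift.translate_apply]
    rw [AddCircle.coe_add, ← Int.cast_neg]
    have : ((((-⌊F 0⌋ : ℤ) : ℝ)) : UnitAddCircle) = 0 := by
      rw [AddCircle.coe_eq_zero_iff]; exact ⟨-⌊F 0⌋, by simp⟩
    rw [this, zero_add]
  · simp only [CircleDeg1Lift.mul_apply, CircleDeg1Lift.translate_apply, Set.mem_Ico]
    constructor
    · linarith [Int.floor_le (F 0)]
    · linarith [Int.lt_floor_add_one (F 0)]

/-- Two lifts of the same homeomorphism differ by an integer. -/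
lemma IsLift.exists_int {F F' : CircleDeg1Lift} {f : UnitAddCircle ≃ₜ UnitAddCircle}
    (hF : IsLift F f) (hF' : IsLift F' f) : ∃ n : ℤ, ∀ x, F x = F' x + n := by
  have key : ∀ x, ∃ n : ℤ, (n : ℝ) = F x - F' x := fun x => by
    have h : (((F x - F' x : ℝ)) : UnitAddCircle) = 0 := by
      rw [AddCircle.coe_sub, hF.2, hF'.2, sub_self]
    obtain ⟨n, hn⟩ := (AddCircle.coe_eq_zero_iff (1 : ℝ)).1 h
    exact ⟨n, by simpa using hn⟩
  choose n hn using key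
  have hc : Continuous n := by
    refine Int.isClosedEmbedding_coe_real.isEmbedding.continuous_iff.2 ?_
    have : ((fun k : ℤ => (k : ℝ)) ∘ n) = fun x => F x - F' x := funext hn
    exact this ▸ hF.1.sub hF'.1
  refine ⟨n 0, fun x => ?_⟩
  have h0 : n x = n 0 := PreconnectedSpace.constant inferInstance hc
  linarith [hn x, congrArg (fun k : ℤ => (k : ℝ)) h0]

lemma IsLift.mul {F F' : CircleDeg1Lift} {f f' : UnitAddCircle ≃ₜ UnitAddCircle}
    (hF : IsLift F f) (hF' : IsLift F' f') : IsLift (F * F') (f * f') := by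
  refine ⟨?_, fun x => ?_⟩
  · rw [CircleDeg1Lift.coe_mul]; exact hF.1.comp hF'.1
  · rw [CircleDeg1Lift.mul_apply, hF.2, hF'.2]; rfl

section Euler

variable {Γ : Type} [Group Γ] (ρ : Γ →* (UnitAddCircle ≃ₜ UnitAddCircle))
  (hρ : ∀ g, OrientationPreserving (ρ g))

/-- The lift `F_g` of the action of `g` with `0 ≤ F_g(0) < 1`. -/
def lift (g : Γ) : CircleDeg1Lift := (hρ g).exists_normalized.choose

lemma lift_isLift (g : Γ) : IsLift (lift ρ hρ g) (ρ g) :=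
  (hρ g).exists_normalized.choose_spec.1

lemma lift_zero_mem (g : Γ) : lift ρ hρ g 0 ∈ Set.Ico (0 : ℝ) 1 :=
  (hρ g).exists_normalized.choose_spec.2

/-- The integer `c(g, h)` with `F_g ∘ F_h = F_{gh} + c(g, h)`. -/
def eulerFun (p : Γ × Γ) : ℤ := ⌊lift ρ hρ p.1 (lift ρ hρ p.2 0)⌋

lemma lift_lift (g h : Γ) (x : ℝ) :
    lift ρ hρ g (lift ρ hρ h x) = lift ρ hρ (g * h) x + eulerFun ρ hρ (g, h) := by
  have hgh : IsLift (lift ρ hρ g * lift ρ hρ h) (ρ (g * h)) := by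
    rw [map_mul]; exact (lift_isLift ρ hρ g).mul (lift_isLift ρ hρ h)
  obtain ⟨n, hn⟩ := hgh.exists_int (lift_isLift ρ hρ (g * h))
  have h0 : eulerFun ρ hρ (g, h) = n := by
    have h1 := hn 0
    rw [CircleDeg1Lift.mul_apply] at h1
    have h2 := lift_zero_mem ρ hρ (g * h)
    rw [eulerFun, Int.floor_eq_iff]
    constructor <;> simp only [h1] <;> linarith [h2.1, h2.2]
  rw [h0, ← hn x, CircleDeg1Lift.mul_apply]

lemma eulerFun_cocycle (g h k : Γ) :
    eulerFun ρ hρ (g * h, k) + eulerFun ρ hρ (g, h) =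
      eulerFun ρ hρ (h, k) + eulerFun ρ hρ (g, h * k) := by
  have h1 := lift_lift ρ hρ g h (lift ρ hρ k 0)
  rw [lift_lift ρ hρ h k, lift_lift ρ hρ (g * h) k, CircleDeg1Lift.map_add_int,
    lift_lift ρ hρ g (h * k), mul_assoc] at h1
  have h2 : ((eulerFun ρ hρ (g * h, k) + eulerFun ρ hρ (g, h) : ℤ) : ℝ) =
      (eulerFun ρ hρ (h, k) + eulerFun ρ hρ (g, h * k) : ℤ) := by
    push_cast; linarith
  exact_mod_cast h2

lemma eulerFun_mem (p : Γ × Γ) : 0 ≤ eulerFun ρ hρ p ∧ eulerFun ρ hρ p ≤ 1 := by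
  have h1 := lift_zero_mem ρ hρ p.1
  have h2 := lift_zero_mem ρ hρ p.2
  have h3 : lift ρ hρ p.1 0 ≤ lift ρ hρ p.1 (lift ρ hρ p.2 0) :=
    (lift ρ hρ p.1).monotone h2.1
  have h4 : lift ρ hρ p.1 (lift ρ hρ p.2 0) ≤ lift ρ hρ p.1 (0 + 1) :=
    (lift ρ hρ p.1).monotone (by linarith [h2.2])
  rw [CircleDeg1Lift.map_add_one] at h4
  constructor
  · exact Int.floor_nonneg.2 (h1.1.trans h3)
  · refine Int.lt_add_one_iff.1 (Int.floor_lt.2 ?_)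
    push_cast; linarith [h1.2]

/-- The Euler cocycle. -/
def eulerCocycle : groupCohomology.cocycles₂ (triv Γ ℤ) :=
  ⟨eulerFun ρ hρ, (groupCohomology.mem_cocycles₂_iff _).2 (eulerFun_cocycle ρ hρ)⟩

/-- The integral Euler class in `H^2(Γ; ℤ)`. -/
def eulerClass : Hup₂ Γ ℤ := groupCohomology.H2π (triv Γ ℤ) (eulerCocycle ρ hρ)

/-- The Euler cocycle as a bounded real cocycle. -/
def boundedEulerCocycle : boundedCocycles Γ :=
  ⟨fun p => (eulerFun ρ hρ p : ℝ),
    (groupCohomology.mem_cocycles₂_iff (A := Rep.trivial ℝ Γ ℝ) _).2 fun g h k => by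
      have := eulerFun_cocycle ρ hρ g h k
      change ((eulerFun ρ hρ (g * h, k) : ℝ) + eulerFun ρ hρ (g, h) =
        eulerFun ρ hρ (h, k) + eulerFun ρ hρ (g, h * k))
      exact_mod_cast this,
    1, fun p => by
      have := eulerFun_mem ρ hρ p
      have h0 : (0 : ℝ) ≤ eulerFun ρ hρ p := by exact_mod_cast this.1
      have h1 : (eulerFun ρ hρ p : ℝ) ≤ 1 := by exact_mod_cast this.2
      exact abs_le.2 ⟨by linarith, h1⟩⟩

/-- The bounded real Euler class in `H^2_b(Γ; ℝ)`. -/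
def boundedEulerClass : Hb₂ Γ := Submodule.Quotient.mk (boundedEulerCocycle ρ hρ)

end Euler

end EulerExt

end

open EulerExt

/-!
Submodules of free `ℤ`-modules are projective, so the `2`-cycles of `Γ` split off the `2`-chains and
every homomorphism `H₂ Γ →+ M` is the evaluation of a class in `H²(Γ; M)`; since `ℝ` is injective
over `ℤ`, evaluation is moreover faithful on `H²(Γ; ℝ)`. Hence, if `⟨eu, ·⟩` vanished, the Euler
cocycle would be the coboundary of a real cochain `u`. As the cocycle is bounded, `u` is a
quasi-morphism; subtracting a homomorphism close to it leaves a bounded cochain with the same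
coboundary, so `eu_b = 0`.

The class `φ` is a class `φ₀` with evaluation `m • id`, corrected by `s_*(ε_* φ₀ - eu)` for a
splitting `s` of `ε`: this does not affect the evaluation, since `ε_* φ₀` and `eu` evaluate alike.
The epimorphism `ψ` comes from sections of the two extensions whose factor sets are related by `ε`.
-/

namespace EulerExt

section HereditaryRing

universe u v w

variable {R : Type u} [Ring R]

theorem baer_of_surjective (hR : ∀ I : Ideal R, Module.Projective R I)
    {M : Type v} {N : Type w} [AddCommGroup M] [Module R M] [AddCommGroup N] [Module R N]
    (hM : Module.Baer R M) {f : M →ₗ[R] N} (hf : Function.Surjective f) : Module.Baer R N := by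
  intro I g
  have := hR I
  obtain ⟨g', hg'⟩ := Module.projective_lifting_property f g hf
  obtain ⟨G, hG⟩ := hM I g'
  exact ⟨f ∘ₗ G, fun x hx => by rw [← hg', LinearMap.comp_apply, hG x hx, LinearMap.comp_apply]⟩

theorem exists_injective_baer (A : Type (max u v)) [AddCommGroup A] [Module R A] :
    ∃ (J : Type (max u v)) (_ : AddCommGroup J) (_ : Module R J) (j : A →ₗ[R] J),
      Function.Injective j ∧ Module.Baer R J := by
  let J : ModuleCat.{max u v} R := CategoryTheory.Injective.under (ModuleCat.of R A)
  let j : ModuleCat.of R A ⟶ J := CategoryTheory.Injective.ι _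
  have : CategoryTheory.Injective (ModuleCat.of R J) := CategoryTheory.Injective.injective_under _
  exact ⟨J, inferInstance, inferInstance, j.hom, (ModuleCat.mono_iff_injective j).1 inferInstance,
    .of_injective (Module.injective_module_of_injective_object R J)⟩

theorem exists_injective_comp_eq_mkQ_comp {X N J : Type*} [AddCommGroup X] [Module R X]
    [AddCommGroup N] [Module R N] [AddCommGroup J] [Module R J] {p : X →ₗ[R] N}
    (hp : Function.Surjective p) {j : X →ₗ[R] J} (hj : Function.Injective j) :
    ∃ g : N →ₗ[R] J ⧸ (LinearMap.ker p).map j, Function.Injective g ∧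
      g ∘ₗ p = ((LinearMap.ker p).map j).mkQ ∘ₗ j := by
  have hgp (x : X) : (LinearMap.ker p).mapQ _ j (Submodule.le_comap_map j _)
      ((p.quotKerEquivOfSurjective hp).symm (p x)) = ((LinearMap.ker p).map j).mkQ (j x) := by
    rw [p.quotKerEquivOfSurjective_symm_apply hp]
    rfl
  refine ⟨(LinearMap.ker p).mapQ _ j (Submodule.le_comap_map j _) ∘ₗ
    (p.quotKerEquivOfSurjective hp).symm, (injective_iff_map_eq_zero _).2 fun n hn => ?_,
    LinearMap.ext hgp⟩
  obtain ⟨x, rfl⟩ := hp n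
  have hx : ((LinearMap.ker p).map j).mkQ (j x) = 0 := (hgp x).symm.trans hn
  rw [Submodule.mkQ_apply, Submodule.Quotient.mk_eq_zero] at hx
  exact (Submodule.comap_map_eq_of_injective hj _).le hx

theorem projective_of_injective (hR : ∀ I : Ideal R, Module.Projective R I)
    {P : Type w} {N : Type v} [AddCommGroup P] [Module R P] [AddCommGroup N] [Module R N]
    [Module.Projective R P] {i : N →ₗ[R] P} (hi : Function.Injective i) :
    Module.Projective R N := by
  -- Embed a free cover `p` of `N` into an injective `J`. Quotients of `J` are injective, so
  -- `N ≃ j(N →₀ R) / j(ker p) → J / j(ker p)` extends to `P`, and the extension lifts to `J`.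
  refine Module.Projective.of_lifting_property'' fun p hp => ?_
  obtain ⟨J, _, _, j, hj, hJ⟩ := exists_injective_baer (R := R) (N →₀ R)
  obtain ⟨g, hg, hgp⟩ := exists_injective_comp_eq_mkQ_comp hp hj
  let K := (LinearMap.ker p).map j
  obtain ⟨G, hG⟩ := (baer_of_surjective hR hJ K.mkQ_surjective).extension_property i hi g
  obtain ⟨L, hL⟩ := Module.projective_lifting_property K.mkQ G K.mkQ_surjective
  have hLp (x : N →₀ R) : K.mkQ (L (i (p x))) = K.mkQ (j x) := calc
    K.mkQ (L (i (p x))) = G (i (p x)) := LinearMap.congr_fun hL _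
    _ = g (p x) := LinearMap.congr_fun hG _
    _ = K.mkQ (j x) := LinearMap.congr_fun hgp x
  have hmem (n : N) : (L ∘ₗ i) n ∈ LinearMap.range j := by
    obtain ⟨x, rfl⟩ := hp n
    obtain ⟨y, -, hy⟩ := (Submodule.Quotient.eq K).1 (hLp x)
    exact ⟨y + x, by rw [map_add, hy, LinearMap.comp_apply, sub_add_cancel]⟩
  let s := (LinearEquiv.ofInjective j hj).symm.toLinearMap ∘ₗ (L ∘ₗ i).codRestrict _ hmem
  have hs (n : N) : j (s n) = L (i n) :=
    congrArg Subtype.val ((LinearEquiv.ofInjective j hj).apply_symm_apply ⟨_, hmem n⟩)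
  refine ⟨s, LinearMap.ext fun n => hg ?_⟩
  obtain ⟨x, rfl⟩ := hp n
  calc g (p (s (p x))) = K.mkQ (j (s (p x))) := LinearMap.congr_fun hgp _
    _ = g (p x) := by rw [hs, hLp]; exact (LinearMap.congr_fun hgp x).symm

end HereditaryRing

section LinearAlgebra

variable {R C P M : Type*} [Ring R] [AddCommGroup C] [Module R C] [AddCommGroup P] [Module R P]
  [AddCommGroup M] [Module R M]

theorem exists_leftInverse_subtype_ker (d : C →ₗ[R] P)
    [Module.Projective R (LinearMap.range d)] :
    ∃ r : C →ₗ[R] LinearMap.ker d, r ∘ₗ (LinearMap.ker d).subtype = LinearMap.id := by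
  obtain ⟨σ, hσ⟩ := Module.projective_lifting_property d.rangeRestrict LinearMap.id
    d.surjective_rangeRestrict
  have hker (x : C) : x - σ (d.rangeRestrict x) ∈ LinearMap.ker d := by
    have hx : d (σ (d.rangeRestrict x)) = d x :=
      congrArg Subtype.val (LinearMap.congr_fun hσ (d.rangeRestrict x))
    rw [LinearMap.mem_ker, map_sub, hx, sub_self]
  refine ⟨(LinearMap.id - σ ∘ₗ d.rangeRestrict : C →ₗ[R] C).codRestrict _ hker,
    LinearMap.ext fun z => Subtype.ext ?_⟩
  have hz : d.rangeRestrict z = 0 := Subtype.ext z.2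
  change (z : C) - σ (d.rangeRestrict z) = z
  rw [hz, map_zero, sub_zero]

theorem exists_comp_eq_of_ker_le (hM : Module.Baer R M) {d : C →ₗ[R] P} {F : C →ₗ[R] M}
    (h : LinearMap.ker d ≤ LinearMap.ker F) : ∃ U : P →ₗ[R] M, U ∘ₗ d = F := by
  obtain ⟨U, hU⟩ := hM.extension_property ((LinearMap.ker d).liftQ d le_rfl)
    (LinearMap.ker_eq_bot.1 ((LinearMap.ker d).ker_liftQ_eq_bot d le_rfl le_rfl))
    ((LinearMap.ker d).liftQ F h)
  refine ⟨U, LinearMap.ext fun x => ?_⟩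
  simpa only [LinearMap.comp_apply, Submodule.mkQ_apply, Submodule.liftQ_apply] using
    LinearMap.congr_fun hU ((LinearMap.ker d).mkQ x)

theorem ne_zero_of_span_singleton_eq_top [Nontrivial M] {x : M}
    (h : Submodule.span R {x} = ⊤) : x ≠ 0 := by
  rintro rfl
  rw [Submodule.span_zero_singleton] at h
  exact bot_ne_top h

end LinearAlgebra

section UniversalCoefficients

variable {Γ : Type} [Group Γ] {M : Type} [AddCommGroup M]

theorem chainPairing_single_one {Γ M : Type} [AddCommGroup M] (F : (Γ × Γ →₀ ℤ) →+ M) :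
    chainPairing (fun p => F (Finsupp.single p 1)) = F := by
  ext p
  simp only [AddMonoidHom.comp_apply, Finsupp.singleAddHom_apply, chainPairing_single, one_smul]

theorem mem_cocycles₂_of_comp_d₃₂ {F : (Γ × Γ →₀ ℤ) →+ M}
    (hF : ∀ w, F (groupHomology.d₃₂ (triv Γ ℤ) w) = 0) :
    (fun p => F (Finsupp.single p 1)) ∈ groupCohomology.cocycles₂ (triv Γ M) := by
  refine (groupCohomology.mem_cocycles₂_def (A := triv Γ M) _).2 fun g h k => ?_
  change F (.single (h, k) 1) - F (.single (g * h, k) 1) + F (.single (g, h * k) 1) -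
    F (.single (g, h) 1) = 0
  have h₀ := hF (Finsupp.single (g, h, k) 1)
  rw [groupHomology.d₃₂_single] at h₀
  change F (Finsupp.single (h, k) 1 - Finsupp.single (g * h, k) 1 +
    Finsupp.single (g, h * k) 1 - Finsupp.single (g, h) 1) = 0 at h₀
  simpa only [map_sub, map_add] using h₀

theorem d₁₂_single_one (U : (Γ →₀ ℤ) →+ M) (p : Γ × Γ) :
    groupCohomology.d₁₂ (triv Γ M) (fun g => U (Finsupp.single g 1)) p =
      U (groupHomology.d₂₁ (triv Γ ℤ) (Finsupp.single p 1)) := by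
  rw [groupHomology.d₂₁_single]
  change _ = U (Finsupp.single p.2 1 - Finsupp.single (p.1 * p.2) 1 + Finsupp.single p.1 1)
  rw [map_add, map_sub]
  rfl

theorem kroneckerEval_surjective :
    Function.Surjective (kroneckerEval : Hup₂ Γ M →+ (H₂ Γ →+ M)) := by
  intro θ
  let d : (Γ × Γ →₀ ℤ) →ₗ[ℤ] (Γ →₀ ℤ) := (groupHomology.d₂₁ (triv Γ ℤ)).hom
  have : Module.Projective ℤ (LinearMap.range d) :=
    projective_of_injective (fun _ => inferInstance) (LinearMap.range d).injective_subtype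
  obtain ⟨r, hr⟩ := exists_leftInverse_subtype_ker d
  let F : (Γ × Γ →₀ ℤ) →+ M := θ.comp ((groupHomology.H2π (triv Γ ℤ)).hom ∘ₗ r).toAddMonoidHom
  have hF (z : groupHomology.cycles₂ (triv Γ ℤ)) : F z.1 = θ (groupHomology.H2π (triv Γ ℤ) z) :=
    congrArg (fun y => θ (groupHomology.H2π (triv Γ ℤ) y)) (LinearMap.congr_fun hr z)
  have hc := mem_cocycles₂_of_comp_d₃₂ (F := F) fun w => by
    let z : groupHomology.cycles₂ (triv Γ ℤ) :=
      ⟨groupHomology.d₃₂ (triv Γ ℤ) w, groupHomology.d₃₂_comp_d₂₁_apply (triv Γ ℤ) w⟩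
    exact (hF z).trans (by rw [(groupHomology.H2π_eq_zero_iff z).2 ⟨w, rfl⟩, map_zero])
  refine ⟨groupCohomology.H2π (triv Γ M) ⟨_, hc⟩, AddMonoidHom.ext fun x => ?_⟩
  obtain ⟨z, rfl⟩ := homologyπ_surjective x
  calc kroneckerEval _ (groupHomology.H2π (triv Γ ℤ) z)
    _ = chainPairing (fun p => F (Finsupp.single p 1)) z.1 := kroneckerEval_apply ⟨_, hc⟩ z
    _ = F z.1 := by rw [chainPairing_single_one]
    _ = θ (groupHomology.H2π (triv Γ ℤ) z) := hF z

theorem kroneckerEval_injective_of_baer (hM : Module.Baer ℤ M) :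
    Function.Injective (kroneckerEval : Hup₂ Γ M →+ (H₂ Γ →+ M)) := by
  refine (injective_iff_map_eq_zero _).2 fun φ hφ => ?_
  obtain ⟨c, rfl⟩ := cohomologyπ_surjective φ
  let d : (Γ × Γ →₀ ℤ) →ₗ[ℤ] (Γ →₀ ℤ) := (groupHomology.d₂₁ (triv Γ ℤ)).hom
  have hc : LinearMap.ker d ≤ LinearMap.ker (chainPairing (c : Γ × Γ → M)).toIntLinearMap :=
    fun z hz => (kroneckerEval_apply c ⟨z, hz⟩).symm.trans (DFunLike.congr_fun hφ _)
  obtain ⟨U, hU⟩ := exists_comp_eq_of_ker_le hM hc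
  refine (groupCohomology.H2π_eq_zero_iff c).2 ⟨fun g => U (Finsupp.single g 1), funext fun p => ?_⟩
  calc _ = U (d (Finsupp.single p 1)) := d₁₂_single_one U.toAddMonoidHom p
    _ = chainPairing (c : Γ × Γ → M) (Finsupp.single p 1) := LinearMap.congr_fun hU _
    _ = c p := by rw [chainPairing_single, one_smul]

end UniversalCoefficients

section CoefficientMap

variable {Γ : Type} [Group Γ] {M N : Type} [AddCommGroup M] [AddCommGroup N]

/-- The cocycle `f ∘ c`, which represents `H²(id_Γ; f)` of the class of `c`. -/
def mapCocycle (f : M →+ N) (c : groupCohomology.cocycles₂ (triv Γ M)) :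
    groupCohomology.cocycles₂ (triv Γ N) :=
  ⟨fun p => f (c p), (groupCohomology.mem_cocycles₂_iff (A := triv Γ N) _).2 fun g h k => by
    have hc := congrArg f ((groupCohomology.mem_cocycles₂_iff c.1).1 c.2 g h k)
    exact (map_add f _ _).symm.trans (hc.trans (map_add f _ _))⟩

theorem coeffMap_H2π (f : M →+ N) (c : groupCohomology.cocycles₂ (triv Γ M)) :
    coeffMap f (groupCohomology.H2π (triv Γ M) c) =
      groupCohomology.H2π (triv Γ N) (mapCocycle f c) :=
  groupCohomology.H2π_comp_map_apply (MonoidHom.id Γ) _ c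

theorem kroneckerEval_coeffMap (f : M →+ N) (φ : Hup₂ Γ M) :
    kroneckerEval (coeffMap f φ) = f.comp (kroneckerEval φ) := by
  ext x
  obtain ⟨c, rfl⟩ := cohomologyπ_surjective φ
  obtain ⟨z, rfl⟩ := homologyπ_surjective x
  calc kroneckerEval (coeffMap f (groupCohomology.H2π (triv Γ M) c)) _
    _ = kroneckerEval (groupCohomology.H2π (triv Γ N) (mapCocycle f c)) _ := by rw [coeffMap_H2π]
    _ = z.1.sum fun p n => n • f (c p) := kroneckerEval_apply _ z
    _ = f (z.1.sum fun p n => n • (c p : M)) := by simp only [map_finsuppSum, map_zsmul]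
    _ = f (kroneckerEval _ _) := congrArg f (kroneckerEval_apply c z).symm

theorem coeffMap_rightInverse {f : M →+ N} {s : N →+ M} (hs : Function.RightInverse s f) :
    Function.RightInverse (coeffMap s : Hup₂ Γ N →+ Hup₂ Γ M) (coeffMap f) := by
  intro φ
  obtain ⟨c, rfl⟩ := cohomologyπ_surjective φ
  have hc : mapCocycle f (mapCocycle s c) = c := Subtype.ext (funext fun p => hs (c p))
  exact (congrArg (coeffMap f) (coeffMap_H2π s c)).trans ((coeffMap_H2π f _).trans (by rw [hc]))

theorem exists_coeffMap_eq_and_kroneckerEval_eq {ε : M →+ N} {s : N →+ M}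
    (hs : Function.RightInverse s ε) {η : Hup₂ Γ N} {θ : H₂ Γ →+ M}
    (h : ε.comp θ = kroneckerEval η) :
    ∃ φ : Hup₂ Γ M, coeffMap ε φ = η ∧ kroneckerEval φ = θ := by
  obtain ⟨φ₀, rfl⟩ := kroneckerEval_surjective θ
  refine ⟨φ₀ - coeffMap s (coeffMap ε φ₀ - η), ?_, ?_⟩
  · rw [map_sub, coeffMap_rightInverse hs, sub_sub_cancel]
  · rw [map_sub, kroneckerEval_coeffMap, map_sub, kroneckerEval_coeffMap, h, sub_self,
      AddMonoidHom.comp_zero, sub_zero]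

end CoefficientMap

section CentralExtension

variable {N N' E E' G : Type*} [Group N] [Group N'] [Group E] [Group E'] [Group G]
  {S : GroupExtension N E G} {T : GroupExtension N' E' G}

/-- `c` is the factor set of the set-theoretic section `s`: it measures the failure of `s` to be
multiplicative, with the correction written on the left as in `HasClass`. -/
def IsFactorSet (s : S.Section) (c : G × G → N) : Prop :=
  ∀ g h, s g * s h = S.inl (c (g, h)) * s (g * h)

theorem exists_eq_inl_mul_section (s : S.Section) (e : E) :
    ∃ n, e = S.inl n * s (S.rightHom e) := by
  have he : e * (s (S.rightHom e))⁻¹ ∈ S.inl.range := by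
    rw [S.range_inl_eq_ker_rightHom, MonoidHom.mem_ker, map_mul, map_inv,
      GroupExtension.Section.rightHom_section, mul_inv_cancel]
  obtain ⟨n, hn⟩ := he
  exact ⟨n, by rw [hn, inv_mul_cancel_right]⟩

theorem IsFactorSet.inl_mul_section_mul (hS : S.inl.range ≤ Subgroup.center E) {s : S.Section}
    {c : G × G → N} (hs : IsFactorSet s c) (n n' : N) (g g' : G) :
    S.inl n * s g * (S.inl n' * s g') = S.inl (n * n' * c (g, g')) * s (g * g') := by
  have hcomm : s g * S.inl n' = S.inl n' * s g := Subgroup.mem_center_iff.1 (hS ⟨n', rfl⟩) (s g)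
  calc S.inl n * s g * (S.inl n' * s g') = S.inl n * (s g * S.inl n') * s g' := by
        simp only [mul_assoc]
    _ = S.inl n * S.inl n' * (s g * s g') := by rw [hcomm]; simp only [mul_assoc]
    _ = S.inl (n * n' * c (g, g')) * s (g * g') := by
        rw [hs, map_mul S.inl, map_mul S.inl]; simp only [mul_assoc]

theorem IsFactorSet.section_one {s : S.Section} {c : G × G → N} (hs : IsFactorSet s c) :
    s 1 = S.inl (c (1, 1)) :=
  mul_right_cancel ((hs 1 1).trans (by rw [mul_one]))

theorem exists_hom_of_isFactorSet (hS : S.inl.range ≤ Subgroup.center E)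
    (hT : T.inl.range ≤ Subgroup.center E') {f : N →* N'} {s : S.Section} {t : T.Section}
    {c : G × G → N} (hs : IsFactorSet s c) (ht : IsFactorSet t (f ∘ c)) :
    ∃ ψ : E →* E', ψ.comp S.inl = T.inl.comp f ∧ T.rightHom.comp ψ = S.rightHom := by
  choose a ha using exists_eq_inl_mul_section s
  have ha_eq {e : E} {n : N} {g : G} (h : e = S.inl n * s g) : a e = n := by
    have hg : S.rightHom e = g := by
      rw [h, map_mul, S.rightHom_inl, one_mul, GroupExtension.Section.rightHom_section]
    exact S.inl_injective (mul_right_cancel ((ha e).symm.trans (hg ▸ h)))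
  have ha_mul (x y : E) : a (x * y) = a x * a y * c (S.rightHom x, S.rightHom y) :=
    ha_eq (by rw [← hs.inl_mul_section_mul hS, ← ha, ← ha])
  have ha_inl (n : N) : a (S.inl n) = n * (c (1, 1))⁻¹ :=
    ha_eq (by rw [hs.section_one, ← map_mul, inv_mul_cancel_right])
  let ψ : E →* E' := MonoidHom.mk' (fun e => T.inl (f (a e)) * t (S.rightHom e)) fun x y => by
    rw [ht.inl_mul_section_mul hT, ha_mul, map_mul S.rightHom, map_mul f, map_mul f,
      Function.comp_apply]
  refine ⟨ψ, MonoidHom.ext fun n => ?_, MonoidHom.ext fun e => ?_⟩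
  · change T.inl (f (a (S.inl n))) * t (S.rightHom (S.inl n)) = T.inl (f n)
    rw [ha_inl, S.rightHom_inl, ht.section_one, ← map_mul, Function.comp_apply, ← map_mul,
      inv_mul_cancel_right]
  · change T.rightHom (T.inl (f (a e)) * t (S.rightHom e)) = S.rightHom e
    rw [map_mul, T.rightHom_inl, one_mul, GroupExtension.Section.rightHom_section]

theorem surjective_of_comp_inl_eq {ψ : E →* E'} {f : N →* N'} (hf : Function.Surjective f)
    (hinl : ψ.comp S.inl = T.inl.comp f) (hr : T.rightHom.comp ψ = S.rightHom) :
    Function.Surjective ψ := by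
  intro y
  obtain ⟨e, he⟩ := S.rightHom_surjective (T.rightHom y)
  have hy : y * (ψ e)⁻¹ ∈ T.inl.range := by
    rw [T.range_inl_eq_ker_rightHom, MonoidHom.mem_ker, map_mul, map_inv, ← he, ← hr,
      MonoidHom.comp_apply, mul_inv_cancel]
  obtain ⟨n', hn'⟩ := hy
  obtain ⟨n, rfl⟩ := hf n'
  have hn : ψ (S.inl n) = T.inl (f n) := DFunLike.congr_fun hinl n
  exact ⟨S.inl n * e, by rw [map_mul, hn, hn', inv_mul_cancel_right]⟩

theorem ker_le_range_inl {ψ : E →* E'} (hr : T.rightHom.comp ψ = S.rightHom) :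
    ψ.ker ≤ S.inl.range := fun e he => by
  rw [S.range_inl_eq_ker_rightHom, MonoidHom.mem_ker, ← hr, MonoidHom.comp_apply,
    MonoidHom.mem_ker.1 he, map_one]

end CentralExtension

section ExtensionClass

variable {Γ : Type} [Group Γ] {M N : Type} [AddCommGroup M] [AddCommGroup N]
  {E E' : Type*} [Group E] [Group E']

theorem HasClass.exists_isFactorSet {S : GroupExtension (Multiplicative M) E Γ} {φ : Hup₂ Γ M}
    (hS : HasClass S φ) {c : groupCohomology.cocycles₂ (triv Γ M)}
    (hc : groupCohomology.H2π (triv Γ M) c = φ) :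
    ∃ s : S.Section, IsFactorSet s fun p => Multiplicative.ofAdd (c p : M) := by
  obtain ⟨hcen, s, c₀, hc₀, hs⟩ := hS
  obtain ⟨u, hu⟩ := (groupCohomology.H2π_eq_iff c c₀).1 (hc.trans hc₀.symm)
  have hu' (g h : Γ) : u g + u h + c₀ (g, h) = (c (g, h) + u (g * h) : M) := by
    have hgh : u h - u (g * h) + u g = c (g, h) - c₀ (g, h) := congrFun hu (g, h)
    rw [eq_sub_iff_add_eq] at hgh
    rw [← hgh]
    abel
  refine ⟨⟨fun g => S.inl (Multiplicative.ofAdd (u g)) * s g, fun g => ?_⟩, fun g h => ?_⟩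
  · rw [map_mul, S.rightHom_inl, one_mul, GroupExtension.Section.rightHom_section]
  · have hs' : IsFactorSet s fun p => Multiplicative.ofAdd (c₀ p : M) := hs
    refine (hs'.inl_mul_section_mul hcen _ _ g h).trans ?_
    change S.inl (Multiplicative.ofAdd (u g + u h + c₀ (g, h))) * s (g * h) =
      S.inl (Multiplicative.ofAdd (c (g, h) : M)) *
        (S.inl (Multiplicative.ofAdd (u (g * h))) * s (g * h))
    rw [hu', ofAdd_add, map_mul, mul_assoc]

theorem exists_surjective_hom_of_coeffMap_eq {S : GroupExtension (Multiplicative M) E Γ}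
    {T : GroupExtension (Multiplicative N) E' Γ} {φ : Hup₂ Γ M} {η : Hup₂ Γ N}
    (hS : HasClass S φ) (hT : HasClass T η) {f : M →+ N} (hf : Function.Surjective f)
    (hφ : coeffMap f φ = η) :
    ∃ ψ : E →* E', Function.Surjective ψ ∧
      (∀ x, ψ (S.inl (Multiplicative.ofAdd x)) = T.inl (Multiplicative.ofAdd (f x))) ∧
      ψ.ker ≤ S.inl.range := by
  obtain ⟨hSc, s, c, rfl, hs⟩ := hS
  obtain ⟨t, ht⟩ := hT.exists_isFactorSet ((coeffMap_H2π f c).symm.trans hφ)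
  obtain ⟨ψ, hinl, hr⟩ := exists_hom_of_isFactorSet hSc hT.1 (f := f.toMultiplicative)
    (c := fun p => Multiplicative.ofAdd (c p : M)) hs ht
  exact ⟨ψ, surjective_of_comp_inl_eq (f := f.toMultiplicative) hf hinl hr,
    fun x => DFunLike.congr_fun hinl (Multiplicative.ofAdd x), ker_le_range_inl hr⟩

end ExtensionClass

theorem exists_zsmul_eq_of_range_eq_zmultiples {A B : Type*} [AddCommGroup A] [AddCommGroup B]
    {f : A →+ B} {b : B} (hb : Function.Injective fun n : ℤ => n • b)
    (hf : f.range = AddSubgroup.zmultiples b) :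
    ∃ ε : A →+ ℤ, Function.Surjective ε ∧ ∀ x, ε x • b = f x := by
  have hx (x : A) : ∃ n : ℤ, n • b = f x :=
    AddSubgroup.mem_zmultiples_iff.1 (hf ▸ ⟨x, rfl⟩)
  choose ε hε using hx
  refine ⟨AddMonoidHom.mk' ε fun x y => hb ?_, fun n => ?_, hε⟩
  · simp only [add_smul, hε, map_add]
  · obtain ⟨x, hx⟩ : n • b ∈ f.range := hf ▸ AddSubgroup.zsmul_mem_zmultiples b n
    exact ⟨x, hb ((hε x).trans hx)⟩

section BoundedEulerClass

variable {Γ : Type} [Group Γ]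

theorem d₁₂_mem_boundedCoboundaries
    (hqm : ∀ f : Γ → ℝ, IsQuasimorphism f → IsTrivialQuasimorphism f) {u : Γ → ℝ}
    (hu : groupCohomology.d₁₂ (Rep.trivial ℝ Γ ℝ) u ∈ boundedFun (Γ × Γ)) :
    (groupCohomology.d₁₂ (Rep.trivial ℝ Γ ℝ) u : Γ × Γ → ℝ) ∈ boundedCoboundaries Γ := by
  obtain ⟨D, hD⟩ := hu
  have hD' (g h : Γ) : |u h - u (g * h) + u g| ≤ D := hD (g, h)
  obtain ⟨χ, K, hK⟩ := hqm u ⟨D, fun g h => by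
    rw [← abs_neg]; convert hD' g h using 2; ring⟩
  refine ⟨fun g => u g - (χ g).toAdd, ⟨K, hK⟩, funext fun ⟨g, h⟩ => ?_⟩
  change (u h - (χ h).toAdd) - (u (g * h) - (χ (g * h)).toAdd) + (u g - (χ g).toAdd) =
    u h - u (g * h) + u g
  rw [map_mul, toAdd_mul]
  ring

theorem kroneckerEval_eulerClass_ne_zero
    {ρ : Γ →* (UnitAddCircle ≃ₜ UnitAddCircle)} {hρ : ∀ g, OrientationPreserving (ρ g)}
    (hqm : ∀ f : Γ → ℝ, IsQuasimorphism f → IsTrivialQuasimorphism f)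
    (hne : boundedEulerClass ρ hρ ≠ 0) : kroneckerEval (eulerClass ρ hρ) ≠ 0 := by
  intro h₀
  have hreal : coeffMap (Int.castAddHom ℝ) (eulerClass ρ hρ) = 0 :=
    kroneckerEval_injective_of_baer (Module.Baer.of_divisible ℝ) <| by
      rw [kroneckerEval_coeffMap, h₀, AddMonoidHom.comp_zero, map_zero]
  obtain ⟨u, hu⟩ := (groupCohomology.H2π_eq_zero_iff _).1 ((coeffMap_H2π _ _).symm.trans hreal)
  have hu' : (groupCohomology.d₁₂ (Rep.trivial ℝ Γ ℝ) u : Γ × Γ → ℝ) =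
      boundedEulerCocycle ρ hρ := hu
  have hmem : (boundedEulerCocycle ρ hρ : Γ × Γ → ℝ) ∈ boundedCoboundaries Γ :=
    hu' ▸ d₁₂_mem_boundedCoboundaries hqm (hu' ▸ (boundedEulerCocycle ρ hρ).2.2)
  exact hne ((Submodule.Quotient.mk_eq_zero _).2 hmem)

end BoundedEulerClass

end EulerExt

theorem proposition3p4_general (Γ : Type) [Group Γ]
    (ρ : Γ →* (UnitAddCircle ≃ₜ UnitAddCircle))
    (hρ : ∀ g, OrientationPreserving (ρ g))
    (hqm : ∀ f : Γ → ℝ, IsQuasimorphism f → IsTrivialQuasimorphism f)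
    (hne : boundedEulerClass ρ hρ ≠ 0) :
    kroneckerEval (eulerClass ρ hρ) ≠ 0 ∧
    ∀ m : ℕ, 0 < m →
      (kroneckerEval (eulerClass ρ hρ)).range = AddSubgroup.zmultiples (m : ℤ) →
      ∃ ε : H₂ Γ →+ ℤ, (∀ x, (m : ℤ) * ε x = kroneckerEval (eulerClass ρ hρ) x) ∧
        (∃ φ : Hup₂ Γ (H₂ Γ),
          coeffMap ε φ = eulerClass ρ hρ ∧ kroneckerEval φ = m • AddMonoidHom.id (H₂ Γ)) ∧
        (∀ φ : Hup₂ Γ (H₂ Γ),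
          coeffMap ε φ = eulerClass ρ hρ →
          ∀ (E : Type*) [Group E] (S : GroupExtension (Multiplicative (H₂ Γ)) E Γ)
            (Γt : Type*) [Group Γt] (T : GroupExtension (Multiplicative ℤ) Γt Γ),
            HasClass S φ → HasClass T (eulerClass ρ hρ) →
            ∃ ψ : E →* Γt, Function.Surjective ψ ∧
              (∀ x : H₂ Γ, ψ (S.inl (Multiplicative.ofAdd x)) =
                T.inl (Multiplicative.ofAdd (ε x))) ∧
              ψ.ker ≤ S.inl.range) := by
  refine ⟨kroneckerEval_eulerClass_ne_zero hqm hne, fun m hm hrange => ?_⟩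
  obtain ⟨ε, hεsurj, hε⟩ := exists_zsmul_eq_of_range_eq_zmultiples
    (mul_left_injective₀ (Int.natCast_ne_zero.2 hm.ne')) hrange
  have hmε (x : H₂ Γ) : (m : ℤ) * ε x = kroneckerEval (eulerClass ρ hρ) x :=
    (mul_comm _ _).trans (hε x)
  obtain ⟨a, ha⟩ := hεsurj 1
  have hsplit : Function.RightInverse (zmultiplesHom (H₂ Γ) a) ε := fun n => by
    rw [zmultiplesHom_apply, map_zsmul, ha, smul_eq_mul, mul_one]
  refine ⟨ε, hmε, exists_coeffMap_eq_and_kroneckerEval_eq hsplit (AddMonoidHom.ext fun x => ?_),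
    fun φ hφ E _ S Γt _ T hS hT => exists_surjective_hom_of_coeffMap_eq hS hT hεsurj hφ⟩
  rw [← hmε x, AddMonoidHom.comp_apply, AddMonoidHom.smul_apply, map_nsmul, nsmul_eq_mul,
    AddMonoidHom.id_apply]

theorem proposition3p4 (Γ : Type) [Group Γ]
    (ρ : Γ →* (UnitAddCircle ≃ₜ UnitAddCircle))
    (hρ : ∀ g, OrientationPreserving (ρ g))
    (hfp : Group.IsFinitelyPresented Γ)
    (hH₁ : Finite (H₁ Γ))
    (hqm : ∀ f : Γ → ℝ, IsQuasimorphism f → IsTrivialQuasimorphism f)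
    (hHb : Nonempty (Hb₂ Γ ≃ₗ[ℝ] ℝ))
    (hgen : Submodule.span ℝ {boundedEulerClass ρ hρ} = ⊤) :
    kroneckerEval (eulerClass ρ hρ) ≠ 0 ∧
    ∀ m : ℕ, 0 < m →
      (kroneckerEval (eulerClass ρ hρ)).range = AddSubgroup.zmultiples (m : ℤ) →
      ∃ ε : H₂ Γ →+ ℤ, (∀ x, (m : ℤ) * ε x = kroneckerEval (eulerClass ρ hρ) x) ∧
        (∃ φ : Hup₂ Γ (H₂ Γ),
          coeffMap ε φ = eulerClass ρ hρ ∧ kroneckerEval φ = m • AddMonoidHom.id (H₂ Γ)) ∧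
        (∀ φ : Hup₂ Γ (H₂ Γ),
          coeffMap ε φ = eulerClass ρ hρ → kroneckerEval φ = m • AddMonoidHom.id (H₂ Γ) →
          ∀ (E : Type*) [Group E] (S : GroupExtension (Multiplicative (H₂ Γ)) E Γ)
            (Γt : Type*) [Group Γt] (T : GroupExtension (Multiplicative ℤ) Γt Γ),
            HasClass S φ → HasClass T (eulerClass ρ hρ) →
            ∃ ψ : E →* Γt, Function.Surjective ψ ∧
              (∀ x : H₂ Γ, ψ (S.inl (Multiplicative.ofAdd x)) =
                T.inl (Multiplicative.ofAdd (ε x))) ∧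
              ψ.ker ≤ S.inl.range) := by
  have : Nontrivial (Hb₂ Γ) := hHb.some.toEquiv.nontrivial
  have hne : boundedEulerClass ρ hρ ≠ 0 := ne_zero_of_span_singleton_eq_top hgen
  exact (proposition3p4_general Γ ρ hρ hqm hne).imp_right fun h m hm hrange =>
    (h m hm hrange).imp fun _ => .imp_right (.imp_right fun hψ φ hφ _ => hψ φ hφ)
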